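/- Let $W=\{W(t)\}_{t\ge 0}$ be a standard Brownian motion. For real parameters $\eta>0$, $\varepsilon>0$ and $\gamma\ge 0$, put, for $t\in[1,\infty)$, $$w_\gamma(t)=\max\Big\{\Big(\frac{t-1}{t}\Big)^{\gamma},\varepsilon\Big\},\qquad w_R(t)=t^{3/2+\eta}\,w_\gamma(t).$$ Then, for any fixed $\eta>0$, $\varepsilon>0$ and $\gamma\ge 0$, the $[0,\infty]$-valued random variable $$\sup_{1\le s\le t<\infty}\{w_R(t)\}^{-1}\,|tW(s)-sW(t)|=\sup_{1\le s\le t<\infty}\frac{1}{t^{3/2+\eta}\max[\{(t-1)/t\}^{\gamma},\varepsilon]}\,|tW(s)-sW(t)|$$ and the $[0,\infty]$-valued random variable $$\sup_{0<u\le v\le 1}\frac{u^{1/2+\eta}}{v\,\max\{(1-u)^{\gamma},\varepsilon\}}\,|W(v)-W(u)|$$ are equal in distribution. -/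

import Mathlib

open MeasureTheory ProbabilityTheory
open scoped NNReal ENNReal

/-- The weight `w_γ(t) = max {((t - 1) / t) ^ γ, ε}`, for `1 ≤ t`. -/
noncomputable def wGamma (γ ε t : ℝ) : ℝ :=
  max (((t - 1) / t) ^ γ) ε

/-- The threshold function `w_R(t) = t ^ (3/2 + η) * w_γ(t)`, for `1 ≤ t`. -/
noncomputable def wR (η γ ε t : ℝ) : ℝ :=
  t ^ (3 / 2 + η) * wGamma γ ε t

/-! Time inversion: `B(t) = t W(1/t)` is again pre-Brownian. With `s = 1/v`, `t = 1/u` one has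
`tW(s) - sW(t) = (B(v) - B(u)) / (uv)`, so the first supremum is, path by path, the second one with
`B` in place of `W`. Path continuity at positive times reduces such a supremum to countably many
pairs, so its law depends only on the finite-dimensional laws, which `B` and `W` share. -/

theorem Dense.iSup_subtype_eq_of_continuous {α β : Type*} [TopologicalSpace α]
    [TopologicalSpace β] [CompleteLattice β] [ClosedIicTopology β] {D : Set α} (hD : Dense D)
    {g : α → β} (hg : Continuous g) : ⨆ d : D, g d = ⨆ x, g x := by
  refine le_antisymm (iSup_le fun d => le_iSup g d) (iSup_le fun x => ?_)
  have hclosed : IsClosed {x | g x ≤ ⨆ d : D, g d} := isClosed_Iic.preimage hg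
  have hsub : D ⊆ {x | g x ≤ ⨆ d : D, g d} := fun d hd => le_iSup (fun d : D => g d) ⟨d, hd⟩
  exact hclosed.closure_subset_iff.2 hsub (hD x)

/-- Restricted to a countable set of times, all pre-Brownian motions have the same law. -/
theorem ProbabilityTheory.IsPreBrownianReal.identDistrib_restrict_countable {Ω : Type*}
    [MeasurableSpace Ω] {P : Measure Ω} [IsProbabilityMeasure P] {X Y : ℝ≥0 → Ω → ℝ}
    (hX : IsPreBrownianReal X P) (hY : IsPreBrownianReal Y P) {C : Set ℝ≥0} (hC : C.Countable) :
    IdentDistrib (fun ω (c : C) => X c ω) (fun ω (c : C) => Y c ω) P P := by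
  have := hC.to_subtype
  refine (identDistrib_iff_forall_finset_identDistrib (X := fun (c : C) => X c)
    (Y := fun (c : C) => Y c)
    (aemeasurable_pi_lambda _ fun c => hX.aemeasurable c)
    (aemeasurable_pi_lambda _ fun c => hY.aemeasurable c)).2 fun I => ?_
  -- `hasLaw` concerns finite sets of times in `ℝ≥0`, so `I` is moved there from `C`.
  set J : Finset ℝ≥0 := I.map (Function.Embedding.subtype _) with hJ
  have hXY : IdentDistrib (fun ω => J.restrict (X · ω)) (fun ω => J.restrict (Y · ω)) P P :=
    ⟨(hX.hasLaw J).aemeasurable, (hY.hasLaw J).aemeasurable,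
      (hX.hasLaw J).map_eq.trans (hY.hasLaw J).map_eq.symm⟩
  have hmem (i : I) : ((i : C) : ℝ≥0) ∈ J :=
    Finset.mem_map_of_mem (Function.Embedding.subtype _) i.2
  have hu : Measurable fun (x : J → ℝ) (i : I) => x ⟨(i : C), hmem i⟩ := by fun_prop
  exact hXY.comp hu

/-- Weighted suprema of increments over a set of pairs of positive times have the same law for
all pre-Brownian motions whose paths are almost surely continuous at positive times. -/
theorem ProbabilityTheory.IsPreBrownianReal.identDistrib_iSup_increments {Ω : Type*}
    [MeasurableSpace Ω] {P : Measure Ω} [IsProbabilityMeasure P] {X Y : ℝ≥0 → Ω → ℝ}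
    (hX : IsPreBrownianReal X P) (hY : IsPreBrownianReal Y P)
    (hXc : ∀ᵐ ω ∂P, ContinuousOn (X · ω) (Set.Ioi 0))
    (hYc : ∀ᵐ ω ∂P, ContinuousOn (Y · ω) (Set.Ioi 0))
    {S : Set (ℝ≥0 × ℝ≥0)} (hS : ∀ p ∈ S, 0 < p.1 ∧ 0 < p.2)
    {f : ℝ≥0 × ℝ≥0 → ℝ} (hf : ContinuousOn f S) :
    IdentDistrib (fun ω => ⨆ p : S, ENNReal.ofReal (f p * |X p.1.2 ω - X p.1.1 ω|))
      (fun ω => ⨆ p : S, ENNReal.ofReal (f p * |Y p.1.2 ω - Y p.1.1 ω|)) P P := by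
  obtain ⟨D, hDc, hD⟩ := TopologicalSpace.exists_countable_dense S
  have hDcount := hDc.to_subtype
  -- The countably many times on which the supremum over `D` depends.
  set C : Set ℝ≥0 := (fun p : S => p.1.1) '' D ∪ (fun p : S => p.1.2) '' D with hCdef
  have hC : C.Countable := (hDc.image _).union (hDc.image _)
  have h1 (d : D) : d.1.1.1 ∈ C := Or.inl ⟨d, d.2, rfl⟩
  have h2 (d : D) : d.1.1.2 ∈ C := Or.inr ⟨d, d.2, rfl⟩
  have hΦ : Measurable fun x : C → ℝ =>
      ⨆ d : D, ENNReal.ofReal (f d.1 * |x ⟨_, h2 d⟩ - x ⟨_, h1 d⟩|) := by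
    refine Measurable.iSup fun d => ENNReal.measurable_ofReal.comp (Measurable.const_mul ?_ _)
    exact Measurable.comp continuous_abs.measurable (by fun_prop)
  have hDS {x : ℝ≥0 → ℝ} (hx : ContinuousOn x (Set.Ioi 0)) :
      ⨆ d : D, ENNReal.ofReal (f d.1 * |x d.1.1.2 - x d.1.1.1|) =
        ⨆ p : S, ENNReal.ofReal (f p * |x p.1.2 - x p.1.1|) := by
    refine hD.iSup_subtype_eq_of_continuous
      (g := fun p : S => ENNReal.ofReal (f p * |x p.1.2 - x p.1.1|))
      (ENNReal.continuous_ofReal.comp (hf.domRestrict.mul (Continuous.abs (Continuous.sub ?_ ?_))))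
    · exact hx.comp_continuous (by fun_prop) fun p => (hS p p.2).2
    · exact hx.comp_continuous (by fun_prop) fun p => (hS p p.2).1
  have key := (hX.identDistrib_restrict_countable hY hC).comp hΦ
  have eX := hXc.mono fun ω hω => hDS hω
  have eY := hYc.mono fun ω hω => hDS hω
  exact ((IdentDistrib.of_ae_eq key.aemeasurable_fst eX).symm.trans key).trans
    (IdentDistrib.of_ae_eq key.aemeasurable_snd eY)

theorem continuousOn_mul_inv_Ioi {x : ℝ≥0 → ℝ} (hx : Continuous x) :
    ContinuousOn (fun t : ℝ≥0 => (t : ℝ) * x (1 / t)) (Set.Ioi 0) := by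
  refine NNReal.continuous_coe.continuousOn.mul (hx.comp_continuousOn ?_)
  exact continuousOn_const.div continuousOn_id fun t ht => (ne_of_gt ht)

/-- The time inversion `s = 1 / v`, `t = 1 / u` in the integrand. -/
theorem weighted_cross_increment_eq (η ε γ a b : ℝ) {u v : ℝ} (hu : 0 < u) (hv : 0 < v) :
    1 / ((1 / u) ^ (3 / 2 + η) * max (((1 / u - 1) / (1 / u)) ^ γ) ε) *
        |1 / u * a - 1 / v * b| =
      u ^ (1 / 2 + η) / (v * max ((1 - u) ^ γ) ε) * |v * a - u * b| := by
  have h1 : (1 / u - 1) / (1 / u) = 1 - u := by field_simp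
  have h2 : 1 / u * a - 1 / v * b = (v * a - u * b) / (u * v) := by field_simp
  have h3 : u ^ (3 / 2 + η) = u ^ (1 / 2 + η) * u := by
    rw [← Real.rpow_add_one hu.ne']; ring_nf
  rw [h1, h2, abs_div, abs_of_pos (mul_pos hu hv), one_div u, Real.inv_rpow hu.le, h3]
  have := Real.rpow_pos_of_pos hu (1 / 2 + η)
  generalize max ((1 - u) ^ γ) ε = m
  generalize u ^ (1 / 2 + η) = r at *
  field_simp

/-- The pairs `(u, v)` with `0 < u ≤ v ≤ 1`. -/
def unitTriangle : Set (ℝ≥0 × ℝ≥0) := {p | 0 < p.1 ∧ p.1 ≤ p.2 ∧ p.2 ≤ 1}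

theorem iSup_unitTriangle (F : ℝ≥0 → ℝ≥0 → ℝ≥0∞) :
    ⨆ p : unitTriangle, F p.1.1 p.1.2 =
      ⨆ (u : ℝ≥0) (v : ℝ≥0) (_ : 0 < u) (_ : u ≤ v) (_ : v ≤ 1), F u v := by
  simp_rw [unitTriangle, iSup_subtype, iSup_prod, Set.mem_ofPred_eq, iSup_and]

theorem iSup_one_le_eq_iSup_unitTriangle (F : ℝ≥0 → ℝ≥0 → ℝ≥0∞) :
    ⨆ (s : ℝ≥0) (t : ℝ≥0) (_ : 1 ≤ s) (_ : s ≤ t), F s t =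
      ⨆ p : unitTriangle, F (1 / p.1.2) (1 / p.1.1) := by
  refine le_antisymm (iSup₂_le fun s t => iSup₂_le fun hs hst => ?_) (iSup_le fun p => ?_)
  · have hs0 : 0 < s := zero_lt_one.trans_le hs
    refine le_iSup_of_le (⟨(1 / t, 1 / s), one_div_pos.2 (hs0.trans_le hst),
      one_div_le_one_div_of_le hs0 hst, ?_⟩ : unitTriangle) ?_
    · simpa using inv_le_one_of_one_le₀ hs
    · simp
  · obtain ⟨⟨u, v⟩, hu, huv, hv⟩ := p
    have hv0 : 0 < v := lt_of_lt_of_le hu huv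
    exact le_iSup₂_of_le (1 / v) (1 / u) (le_iSup₂_of_le (one_le_one_div hv0 hv)
      (one_div_le_one_div_of_le hu huv) le_rfl)

theorem continuousOn_weight_unitTriangle {η ε γ : ℝ} (hε : 0 < ε) (hγ : 0 ≤ γ) :
    ContinuousOn (fun p : ℝ≥0 × ℝ≥0 =>
      (p.1 : ℝ) ^ (1 / 2 + η) / ((p.2 : ℝ) * max ((1 - (p.1 : ℝ)) ^ γ) ε)) unitTriangle := by
  refine ContinuousOn.div ?_ (Continuous.continuousOn ?_) fun p hp => ?_
  · refine ContinuousOn.rpow_const (by fun_prop) fun p hp => Or.inl ?_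
    exact_mod_cast hp.1.ne'
  -- `γ ≥ 0` is needed at `u = 1`, where the base `1 - u` vanishes.
  · have := Real.continuous_rpow_const hγ
    fun_prop
  · have h2 : (0 : ℝ) < p.2 := by exact_mod_cast hp.1.trans_le hp.2.1
    exact (mul_pos h2 (lt_max_of_lt_right hε)).ne'

theorem proposition2 {Ω : Type*} [MeasurableSpace Ω] (P : Measure Ω) [IsProbabilityMeasure P]
    (W : ℝ≥0 → Ω → ℝ) (hW : IsBrownianReal W P)
    (η ε γ : ℝ) (hη : 0 < η) (hε : 0 < ε) (hγ : 0 ≤ γ) :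
    (∀ ω : Ω,
      (⨆ (s : ℝ≥0) (t : ℝ≥0) (_ : 1 ≤ s) (_ : s ≤ t),
          ENNReal.ofReal ((wR η γ ε (t : ℝ))⁻¹ * |(t : ℝ) * W s ω - (s : ℝ) * W t ω|)) =
        ⨆ (s : ℝ≥0) (t : ℝ≥0) (_ : 1 ≤ s) (_ : s ≤ t),
          ENNReal.ofReal
            (1 / ((t : ℝ) ^ (3 / 2 + η) * max ((((t : ℝ) - 1) / (t : ℝ)) ^ γ) ε) *
              |(t : ℝ) * W s ω - (s : ℝ) * W t ω|)) ∧
    IdentDistrib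
      (fun ω : Ω => ⨆ (s : ℝ≥0) (t : ℝ≥0) (_ : 1 ≤ s) (_ : s ≤ t),
        ENNReal.ofReal
          (1 / ((t : ℝ) ^ (3 / 2 + η) * max ((((t : ℝ) - 1) / (t : ℝ)) ^ γ) ε) *
            |(t : ℝ) * W s ω - (s : ℝ) * W t ω|))
      (fun ω : Ω => ⨆ (u : ℝ≥0) (v : ℝ≥0) (_ : 0 < u) (_ : u ≤ v) (_ : v ≤ 1),
        ENNReal.ofReal
          ((u : ℝ) ^ (1 / 2 + η) / ((v : ℝ) * max ((1 - (u : ℝ)) ^ γ) ε) *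
            |W v ω - W u ω|))
      P P := by
  refine ⟨fun ω => by simp only [wR, wGamma, one_div], ?_⟩
  have hcont : ∀ᵐ ω ∂P, ContinuousOn (W · ω) (Set.Ioi 0) :=
    hW.cont.mono fun ω hω => hω.continuousOn
  -- Excluding time `0` avoids having to show `W(t)/t → 0` at infinity.
  have hinv : ∀ᵐ ω ∂P, ContinuousOn (fun t : ℝ≥0 => (t : ℝ) * W (1 / t) ω) (Set.Ioi 0) :=
    hW.cont.mono fun ω hω => continuousOn_mul_inv_Ioi hω
  have key := hW.toIsPreBrownianReal.inv.identDistrib_iSup_increments hW.toIsPreBrownianReal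
    hinv hcont (S := unitTriangle) (fun p hp => ⟨hp.1, hp.1.trans_le hp.2.1⟩)
    (continuousOn_weight_unitTriangle (η := η) hε hγ)
  convert key using 2 with ω ω
  · rw [iSup_one_le_eq_iSup_unitTriangle]
    refine iSup_congr fun p => ?_
    have hu : (0 : ℝ) < p.1.1 := by exact_mod_cast p.2.1
    have hv : (0 : ℝ) < p.1.2 := by exact_mod_cast p.2.1.trans_le p.2.2.1
    rw [← weighted_cross_increment_eq η ε γ _ _ hu hv]
    push_cast
    rfl
  · exact (iSup_unitTriangle _).symm
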